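/- There is an absolute constant $c>0$ such that for every integer $n\ge 3$ there exists a set $P$ of $n$ points in the Euclidean plane, no three of them collinear, that spans at least $c\,n\log n$ triangles of minimum nonzero area; that is, at least $c\,n\log n$ three-element subsets of $P$ are vertex sets of nondegenerate triangles whose area equals the minimum of the nonzero areas of all triangles with vertices in $P$. -/

import Mathlib

/-- The Euclidean plane. -/
abbrev Plane : Type := EuclideanSpace ℝ (Fin 2)

/-- The area of the (possibly degenerate) triangle with vertices `p`, `q`, `r`. -/
noncomputable def triangleArea (p q r : Plane) : ℝ :=
  |(q 0 - p 0) * (r 1 - p 1) - (r 0 - p 0) * (q 1 - p 1)| / 2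

/-- No three distinct points of `P` lie on a line. -/
def NoThreeCollinear (P : Finset Plane) : Prop :=
  ∀ p ∈ P, ∀ q ∈ P, ∀ r ∈ P, p ≠ q → p ≠ r → q ≠ r →
    ¬ Collinear ℝ ({p, q, r} : Set Plane)

/-- `t` is the vertex set of a triangle spanned by `P` whose area is the minimum of the
nonzero areas of the triangles spanned by `P`. -/
def IsMinAreaTriangle (P t : Finset Plane) : Prop :=
  ∃ p ∈ P, ∃ q ∈ P, ∃ r ∈ P, (t : Set Plane) = {p, q, r} ∧ 0 < triangleArea p q r ∧
    ∀ p' ∈ P, ∀ q' ∈ P, ∀ r' ∈ P,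
      0 < triangleArea p' q' r' → triangleArea p q r ≤ triangleArea p' q' r'

/-- The number of triangles of minimum nonzero area spanned by `P`; a triangle is identified
with its set of vertices, so that it is counted once. -/
noncomputable def numMinAreaTriangles (P : Finset Plane) : ℕ :=
  Set.ncard {t : Finset Plane | IsMinAreaTriangle P t}

/-! A nondegenerate lattice triangle has area at least 1/2, so in a lattice set the unimodular
triangles, if there are any, are those of minimum area. Double `P` to `P ∪ (P + s)` with `cross w s
= 1`: both copies keep their triangles, and each pair `p`, `p + w` in `P` spans a new one with `p +
s`. If at least a quarter of the points begin such a pair, then T(2N) ≥ 2T(N) + N/4, so T(N) is at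
least of order N log N.

To iterate, the frequent differences must be renewed: in the double, `s` occurs at least |P| times
and `s + v` at least as often as `v` did in `P`, so `(v, w)` becomes `(s, s + v)`. Every `s = u - k
w` has `cross w s = 1`; a suitable progression of `k` makes `s + v` primitive, and large `k` avoids
collinear triples except along `w`, where `gap` excludes them (`DoublingData.exists_double`). Sizes
between powers of two are reached by adding points of a parabola. -/

/-- The cross product of two integer vectors. -/
def cross (a b : ℤ × ℤ) : ℤ := a.1 * b.2 - a.2 * b.1

/-- No three distinct points of the finite lattice set `S` are collinear. -/
def LatticeGeneral (S : Finset (ℤ × ℤ)) : Prop :=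
  ∀ p ∈ S, ∀ q ∈ S, ∀ r ∈ S, p ≠ q → p ≠ r → q ≠ r → cross (q - p) (r - p) ≠ 0

/-- `t` is the vertex set of a lattice triangle of area `1 / 2`. -/
def Unimodular (t : Finset (ℤ × ℤ)) : Prop :=
  ∃ p q r, t = {p, q, r} ∧ |cross (q - p) (r - p)| = 1

open Classical in
/-- The triangles of area `1 / 2` spanned by `S`. -/
noncomputable def unimodularTriangles (S : Finset (ℤ × ℤ)) : Finset (Finset (ℤ × ℤ)) :=
  S.powerset.filter Unimodular

theorem mem_unimodularTriangles {S t : Finset (ℤ × ℤ)} :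
    t ∈ unimodularTriangles S ↔ t ⊆ S ∧ Unimodular t := by
  simp [unimodularTriangles]

/-- The points of `S` whose translate by `v` is again in `S`. -/
def translatePairs (S : Finset (ℤ × ℤ)) (v : ℤ × ℤ) : Finset (ℤ × ℤ) :=
  S.filter fun p => p + v ∈ S

/-- A finite lattice set in general position with two frequent differences `v` and `w`, such that
the lines of direction `w` adjacent to a point of `P` contain no point of `P`. -/
structure DoublingData (P : Finset (ℤ × ℤ)) (v w u : ℤ × ℤ) : Prop where
  general : LatticeGeneral P
  basis : cross w u = 1
  two_le : 2 ≤ cross w v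
  parallel : ∀ p ∈ P, ∀ q ∈ P, cross w (q - p) = 0 → q = p ∨ q = p + w ∨ p = q + w
  gap : ∀ p ∈ P, ∀ q ∈ P, cross w (q - p) ≠ 1
  card_le_v : P.card ≤ 2 * (translatePairs P v).card
  card_le_w : P.card ≤ 4 * (translatePairs P w).card

/-- The gap holds by parity: `cross (1, 2) (x, y) = y - 2 * x` is even on this rectangle. -/
theorem doublingData_base :
    DoublingData {(0, 0), (1, 0), (0, 2), (1, 2)} (0, 2) (1, 2) (0, 1) where
  general := by unfold LatticeGeneral; decide
  basis := by decide
  two_le := by decide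
  parallel := by decide
  gap := by decide
  card_le_v := by decide
  card_le_w := by decide

theorem eq_mul_of_cross_eq_zero {w u e : ℤ × ℤ} (hu : cross w u = 1) (he : cross w e = 0) :
    e = (cross e u * w.1, cross e u * w.2) := by
  simp only [cross] at *
  ext
  · simp only; linear_combination (-e.1) * hu + u.1 * he
  · simp only; linear_combination (-e.2) * hu + u.2 * he

/-! ### The translation vector -/

/-- The translation vector used to double a configuration. -/
def shiftVector (v w u : ℤ × ℤ) (l : ℤ) : ℤ × ℤ :=
  (u.1 - (cross v u - 1 + (cross w v + 1) * l) * w.1,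
   u.2 - (cross v u - 1 + (cross w v + 1) * l) * w.2)

theorem cross_shiftVector (v w u e : ℤ × ℤ) (l : ℤ) :
    cross (shiftVector v w u l) e =
      cross u e - (cross v u - 1) * cross w e - (cross w v + 1) * cross w e * l := by
  simp only [cross, shiftVector]; ring

/-- The cross product is affine in `l`, with slope `-(cross w v + 1) * cross w e ≠ 0`. -/
theorem eventually_lt_abs_cross_shiftVector {v w : ℤ × ℤ} (u : ℤ × ℤ) (h : 2 ≤ cross w v)
    (K : ℤ) {e : ℤ × ℤ} (he : cross w e ≠ 0) :
    ∀ᶠ l : ℤ in Filter.atTop, K < |cross (shiftVector v w u l) e| := by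
  set A := cross u e - (cross v u - 1) * cross w e with hA
  filter_upwards [Filter.eventually_ge_atTop (|A| + |K| + 1)] with l hl
  rw [cross_shiftVector, ← hA]
  have h1 : 1 ≤ |(cross w v + 1) * cross w e| :=
    Int.one_le_abs (mul_ne_zero (by omega) he)
  have hl0 : 0 ≤ l := by linarith [abs_nonneg A, abs_nonneg K]
  have h2 : l ≤ |(cross w v + 1) * cross w e * l| := by
    rw [abs_mul, abs_of_nonneg hl0]; nlinarith
  have h3 := abs_sub_abs_le_abs_sub ((cross w v + 1) * cross w e * l) A
  rw [abs_sub_comm _ A] at h3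
  have := le_abs_self K
  linarith

/-! ### Doubling: counting triangles -/

theorem card_union_image_add {P : Finset (ℤ × ℤ)} {s : ℤ × ℤ}
    (h : ∀ p ∈ P, p + s ∉ P) : (P ∪ P.image (· + s)).card = 2 * P.card := by
  rw [Finset.card_union_of_disjoint, Finset.card_image_of_injective _ (add_left_injective s)]
  · ring
  · rw [Finset.disjoint_right]
    intro x hx
    obtain ⟨p, hp, rfl⟩ := Finset.mem_image.1 hx
    exact h p hp

theorem Unimodular.image_add {t : Finset (ℤ × ℤ)} (ht : Unimodular t) (s : ℤ × ℤ) :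
    Unimodular (t.image (· + s)) := by
  obtain ⟨p, q, r, rfl, h⟩ := ht
  refine ⟨p + s, q + s, r + s, by simp [Finset.image_insert], ?_⟩
  simpa using h

/-- Doubling `P` by a vector `s` with `cross w s = 1` doubles the unimodular triangles and adds one
for each pair of points of `P` that differ by `w`. -/
theorem card_unimodularTriangles_union {P : Finset (ℤ × ℤ)} {w s : ℤ × ℤ}
    (hws : cross w s = 1) (h : ∀ p ∈ P, p + s ∉ P) :
    2 * (unimodularTriangles P).card + (translatePairs P w).card ≤
      (unimodularTriangles (P ∪ P.image (· + s))).card := by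
  have hdisj : ∀ x ∈ P.image (· + s), x ∉ P := by
    intro x hx
    obtain ⟨p, hp, rfl⟩ := Finset.mem_image.1 hx
    exact h p hp
  have hinj : Function.Injective (fun t : Finset (ℤ × ℤ) => t.image (· + s)) :=
    Finset.image_injective (add_left_injective s)
  set B := (unimodularTriangles P).image (fun t => t.image (· + s)) with hB
  set C := (translatePairs P w).image (fun p => ({p, p + w, p + s} : Finset (ℤ × ℤ))) with hC
  have hBmem : ∀ t ∈ B, t ⊆ P.image (· + s) ∧ Unimodular t := by
    intro t ht
    obtain ⟨a, ha, rfl⟩ := Finset.mem_image.1 ht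
    rw [mem_unimodularTriangles] at ha
    exact ⟨Finset.image_subset_image ha.1, ha.2.image_add s⟩
  have hCmem : ∀ t ∈ C, ∃ p ∈ P, p + w ∈ P ∧ t = {p, p + w, p + s} := by
    intro t ht
    obtain ⟨p, hp, rfl⟩ := Finset.mem_image.1 ht
    obtain ⟨hp1, hp2⟩ := Finset.mem_filter.1 hp
    exact ⟨p, hp1, hp2, rfl⟩
  have hBcard : B.card = (unimodularTriangles P).card := Finset.card_image_of_injective _ hinj
  have hCcard : C.card = (translatePairs P w).card := by
    refine Finset.card_image_of_injOn ?_
    intro p hp q hq hpq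
    obtain ⟨hp1, hp2⟩ := Finset.mem_filter.1 hp
    obtain ⟨hq1, hq2⟩ := Finset.mem_filter.1 hq
    -- `p + s` is the only vertex outside `P`, so the triangle determines `p`.
    have hmem : p + s ∈ ({q, q + w, q + s} : Finset (ℤ × ℤ)) := by
      have : p + s ∈ ({p, p + w, p + s} : Finset (ℤ × ℤ)) := by simp
      simpa only [hpq] using this
    simp only [Finset.mem_insert, Finset.mem_singleton] at hmem
    rcases hmem with h1 | h1 | h1
    · exact absurd (h1 ▸ hq1) (h p hp1)
    · exact absurd (h1 ▸ hq2) (h p hp1)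
    · exact add_right_cancel h1
  have hAB : Disjoint (unimodularTriangles P) B := by
    rw [Finset.disjoint_left]
    intro t ht htB
    obtain ⟨htP, p, q, r, rfl, -⟩ := mem_unimodularTriangles.1 ht
    have hp : p ∈ ({p, q, r} : Finset (ℤ × ℤ)) := by simp
    exact hdisj p ((hBmem _ htB).1 hp) (htP hp)
  have hABC : Disjoint (unimodularTriangles P ∪ B) C := by
    rw [Finset.disjoint_right]
    intro t htC ht
    obtain ⟨p, hp, -, rfl⟩ := hCmem t htC
    rcases Finset.mem_union.1 ht with ht | ht
    · exact h p hp ((mem_unimodularTriangles.1 ht).1 (by simp))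
    · exact hdisj p ((hBmem _ ht).1 (by simp)) hp
  calc 2 * (unimodularTriangles P).card + (translatePairs P w).card
      = ((unimodularTriangles P ∪ B) ∪ C).card := by
        rw [Finset.card_union_of_disjoint hABC, Finset.card_union_of_disjoint hAB, hBcard, hCcard]
        ring
    _ ≤ _ := by
        refine Finset.card_le_card fun t ht => ?_
        rw [mem_unimodularTriangles]
        rcases Finset.mem_union.1 ht with ht | ht
        · rcases Finset.mem_union.1 ht with ht | ht
          · exact ⟨(mem_unimodularTriangles.1 ht).1.trans Finset.subset_union_left,
              (mem_unimodularTriangles.1 ht).2⟩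
          · exact ⟨(hBmem t ht).1.trans Finset.subset_union_right, (hBmem t ht).2⟩
        · obtain ⟨p, hp, hpw, rfl⟩ := hCmem t ht
          refine ⟨?_, p, p + w, p + s, rfl, by simp [hws]⟩
          intro x hx
          simp only [Finset.mem_insert, Finset.mem_singleton] at hx
          rcases hx with rfl | rfl | rfl
          · exact Finset.mem_union_left _ hp
          · exact Finset.mem_union_left _ hpw
          · exact Finset.mem_union_right _ (Finset.mem_image_of_mem _ hp)

/-! ### Doubling: general position and the new data -/

/-- A set doubled by a translation `s` stays in general position if no line through two points of
one copy meets the other copy. -/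
theorem LatticeGeneral.union_image_add {P : Finset (ℤ × ℤ)} {s : ℤ × ℤ} (hP : LatticeGeneral P)
    (hs : ∀ p ∈ P, ∀ q ∈ P, ∀ r ∈ P, p ≠ q →
      cross (q - p) (r + s - p) ≠ 0 ∧ cross (q - p) (r - s - p) ≠ 0) :
    LatticeGeneral (P ∪ P.image (· + s)) := by
  intro p hp q hq r hr hpq hpr hqr h0
  simp only [Finset.mem_union, Finset.mem_image] at hp hq hr
  rcases hp with hp | ⟨p, hp, rfl⟩ <;> rcases hq with hq | ⟨q, hq, rfl⟩ <;>
    rcases hr with hr | ⟨r, hr, rfl⟩ <;>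
    simp only [ne_eq, add_left_inj] at hpq hpr hqr
  · exact hP p hp q hq r hr hpq hpr hqr h0
  · exact (hs p hp q hq r hr hpq).1 h0
  · refine (hs p hp r hr q hq hpr).1 ?_
    simp only [cross, Prod.fst_sub, Prod.snd_sub, Prod.fst_add, Prod.snd_add] at h0 ⊢
    linear_combination -h0
  · refine (hs q hq r hr p hp hqr).2 ?_
    simp only [cross, Prod.fst_sub, Prod.snd_sub, Prod.fst_add, Prod.snd_add] at h0 ⊢
    linear_combination h0
  · refine (hs q hq r hr p hp hqr).1 ?_
    simp only [cross, Prod.fst_sub, Prod.snd_sub, Prod.fst_add, Prod.snd_add] at h0 ⊢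
    linear_combination h0
  · refine (hs p hp r hr q hq hpr).2 ?_
    simp only [cross, Prod.fst_sub, Prod.snd_sub, Prod.fst_add, Prod.snd_add] at h0 ⊢
    linear_combination -h0
  · refine (hs p hp q hq r hr hpq).2 ?_
    simp only [cross, Prod.fst_sub, Prod.snd_sub, Prod.fst_add, Prod.snd_add] at h0 ⊢
    linear_combination h0
  · refine hP p hp q hq r hr hpq hpr hqr ?_
    simpa using h0

/-- The direction of the doubled configuration meets it only in the expected way. -/
theorem cross_shift_add {v w u : ℤ × ℤ} (hu : cross w u = 1) (hv : 2 ≤ cross w v) {l : ℤ}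
    {d : ℤ × ℤ} {ε : ℤ}
    (hbig : cross w (d - ε • v) ≠ 0 →
      |cross v d| + 1 < |cross (shiftVector v w u l) (d - ε • v)|) :
    d = ε • v ∨ 2 ≤ |cross (shiftVector v w u l + v) (d + ε • shiftVector v w u l)| := by
  set s := shiftVector v w u l with hs
  -- `ε` records which copies contain the two ends of a difference. The identity trades the shift by
  -- `s` for one by `v`.
  have key : cross (s + v) (d + ε • s) = cross s (d - ε • v) + cross v d := by
    simp only [cross, Prod.fst_sub, Prod.snd_sub, Prod.fst_add, Prod.snd_add, Prod.smul_fst,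
      Prod.smul_snd, smul_eq_mul]
    ring
  by_cases h : cross w (d - ε • v) = 0
  · have he := eq_mul_of_cross_eq_zero hu h
    set m := cross (d - ε • v) u
    by_cases hm : m = 0
    · left
      rw [hm] at he
      exact sub_eq_zero.1 (he.trans (by simp))
    · right
      have hd : d = ε • v + (m * w.1, m * w.2) := by rw [← he]; abel
      -- Along `w` the value does not depend on `l`; it is a nonzero multiple of `cross w v + 1 ≥
      -- 3`.
      have hval : cross (s + v) (d + ε • s) = -(m * (cross w v + 1)) := by
        rw [key, he, hs, cross_shiftVector, hd]
        simp only [cross, Prod.fst_add, Prod.snd_add, Prod.smul_fst,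
          Prod.smul_snd, smul_eq_mul] at hu ⊢
        linear_combination (-m) * hu
      rw [hval, abs_neg, abs_mul, abs_of_nonneg (by omega : 0 ≤ cross w v + 1)]
      have := Int.one_le_abs hm
      nlinarith
  · right
    have h1 := hbig h
    rw [key]
    have h2 := abs_sub_abs_le_abs_sub (cross s (d - ε • v)) (-cross v d)
    rw [abs_neg, sub_neg_eq_add] at h2
    omega

theorem DoublingData.exists_double {P : Finset (ℤ × ℤ)} {v w u : ℤ × ℤ}
    (hD : DoublingData P v w u) :
    ∃ P' v' w' u', DoublingData P' v' w' u' ∧ P'.card = 2 * P.card ∧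
      2 * (unimodularTriangles P).card + (translatePairs P w).card ≤
        (unimodularTriangles P').card := by
  have hwv := hD.two_le
  have hu := hD.basis
  have ev1 : ∀ᶠ l : ℤ in Filter.atTop, ∀ p ∈ P, ∀ q ∈ P, ∀ r ∈ P, cross w (q - p) ≠ 0 →
      |cross (q - p) (r - p)| < |cross (shiftVector v w u l) (q - p)| := by
    simp only [Filter.eventually_all_finset, Filter.eventually_imp_distrib_left]
    intro p _ q _ r _ h
    exact eventually_lt_abs_cross_shiftVector u hwv _ h
  have ev2 : ∀ᶠ l : ℤ in Filter.atTop, ∀ p ∈ P, ∀ q ∈ P, ∀ ε ∈ ({0, 1, -1} : Finset ℤ),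
      cross w (q - p - ε • v) ≠ 0 →
      |cross v (q - p)| + 1 < |cross (shiftVector v w u l) (q - p - ε • v)| := by
    simp only [Filter.eventually_all_finset, Filter.eventually_imp_distrib_left]
    intro p _ q _ r _ h
    exact eventually_lt_abs_cross_shiftVector u hwv _ h
  -- `h1` serves general position, `h2` the separation along `s + v`, and `h3` the bound `two_le` of
  -- the new data.
  obtain ⟨l, h1, h2, h3⟩ := (ev1.and (ev2.and
    (Filter.eventually_ge_atTop (|cross v u - (cross v u - 1) * cross v w| + 2)))).exists
  set s := shiftVector v w u l with hs
  have hws : cross w s = 1 := by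
    rw [← hu, hs]; simp only [cross, shiftVector]; ring
  have hgap : ∀ p ∈ P, ∀ q ∈ P, cross w (q - p) ≠ -1 := by
    intro p hp q hq h
    refine hD.gap q hq p hp ?_
    simp only [cross, Prod.fst_sub, Prod.snd_sub] at h ⊢
    linear_combination -h
  have hdisj : ∀ p ∈ P, p + s ∉ P := by
    intro p hp hps
    exact hD.gap p hp _ hps (by simpa using hws)
  have hcard := card_union_image_add hdisj
  set P' := P ∪ P.image (· + s) with hP'
  have hleft : ∀ p ∈ P, p ∈ P' := fun p hp => Finset.mem_union_left _ hp
  have hright : ∀ p ∈ P, p + s ∈ P' := fun p hp =>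
    Finset.mem_union_right _ (Finset.mem_image_of_mem _ hp)
  have hsep : ∀ p ∈ P', ∀ q ∈ P', (q = p ∨ q = p + (s + v) ∨ p = q + (s + v)) ∨
      2 ≤ |cross (s + v) (q - p)| := by
    have main : ∀ p ∈ P, ∀ q ∈ P, ∀ ε ∈ ({0, 1, -1} : Finset ℤ),
        q - p = ε • v ∨ 2 ≤ |cross (s + v) (q - p + ε • s)| :=
      fun p hp q hq ε hε => cross_shift_add hu hwv (h2 p hp q hq ε hε)
    intro p hp q hq
    simp only [hP', Finset.mem_union, Finset.mem_image] at hp hq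
    rcases hp with hp | ⟨p, hp, rfl⟩ <;> rcases hq with hq | ⟨q, hq, rfl⟩
    · rcases main p hp q hq 0 (by simp) with h | h
      · left; left; simpa [sub_eq_zero] using h
      · right; simpa using h
    · rcases main p hp q hq 1 (by simp) with h | h
      · left; right; left
        rw [one_smul, sub_eq_iff_eq_add] at h
        rw [h]; abel
      · right
        rwa [one_smul, show q - p + s = q + s - p by abel] at h
    · rcases main p hp q hq (-1) (by simp) with h | h
      · left; right; right
        rw [neg_smul, one_smul, sub_eq_iff_eq_add] at h
        rw [h]; abel
      · right
        rwa [neg_smul, one_smul, show q - p + -s = q - (p + s) by abel] at h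
    · rcases main p hp q hq 0 (by simp) with h | h
      · left; left; simpa [sub_eq_zero] using h
      · right; simpa using h
  refine ⟨P', s, s + v, (u.1 - l * w.1, u.2 - l * w.2), ⟨?_, ?_, ?_, ?_, ?_, ?_, ?_⟩, hcard,
    card_unimodularTriangles_union hws hdisj⟩
  · refine hD.general.union_image_add fun p hp q hq r hr hpq => ?_
    have e1 : cross (q - p) (r + s - p) = cross (q - p) (r - p) - cross s (q - p) := by
      simp only [cross, Prod.fst_sub, Prod.snd_sub, Prod.fst_add, Prod.snd_add]; ring
    have e2 : cross (q - p) (r - s - p) = cross (q - p) (r - p) + cross s (q - p) := by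
      simp only [cross, Prod.fst_sub, Prod.snd_sub]; ring
    -- Along `w` a large `l` does not help: `cross s (q - p) = ±1`. Here `gap` forbids the values
    -- `±1` of `cross w (r - p)`.
    by_cases h : cross w (q - p) = 0
    · have g1 := hD.gap p hp r hr
      have g2 := hgap p hp r hr
      have hsw : cross s w = -1 := by
        rw [← hws]; simp only [cross]; ring
      have hcase : q - p = w ∨ q - p = -w := by
        rcases hD.parallel p hp q hq h with h | h | h
        · exact absurd h.symm hpq
        · left; rw [h]; abel
        · right; rw [h]; abel
      rw [e1, e2]
      rcases hcase with hc | hc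
      · rw [hc, hsw]
        constructor <;> intro h0 <;> omega
      · have n1 : cross (-w) (r - p) = -cross w (r - p) := by simp [cross]; ring
        have n2 : cross s (-w) = -cross s w := by simp [cross]; ring
        rw [hc, n1, n2, hsw]
        constructor <;> intro h0 <;> omega
    · have hb := h1 p hp q hq r hr h
      rw [e1, e2]
      constructor
      · intro h0
        rw [sub_eq_zero.1 h0] at hb
        exact lt_irrefl _ hb
      · intro h0
        rw [eq_neg_of_add_eq_zero_left h0, abs_neg] at hb
        exact lt_irrefl _ hb
  -- The coefficient of `w` in `shiftVector` is chosen for this: the terms in `l` and `cross v u`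
  -- cancel, leaving 1.
  · rw [hs]
    simp only [cross, shiftVector, Prod.fst_add, Prod.snd_add] at hu ⊢
    linear_combination
      (-(v.1 * u.2 - v.2 * u.1 - 1 + (w.1 * v.2 - w.2 * v.1 + 1) * l) + l) * hu
  · have e : cross (s + v) s = - cross s v := by simp only [cross, Prod.fst_add, Prod.snd_add]; ring
    have e' : -cross s v = cross v u - (cross v u - 1) * cross v w +
        (cross w v + 1) * cross w v * l := by
      rw [hs, cross_shiftVector]; simp only [cross]; ring
    rw [e, e']
    have a1 := neg_abs_le (cross v u - (cross v u - 1) * cross v w)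
    have a2 := abs_nonneg (cross v u - (cross v u - 1) * cross v w)
    have hl0 : 0 ≤ l := by linarith
    have : 1 * l ≤ (cross w v + 1) * cross w v * l :=
      mul_le_mul_of_nonneg_right (by nlinarith) hl0
    linarith
  · intro p hp q hq h
    rcases hsep p hp q hq with h' | h'
    · exact h'
    · rw [h] at h'; norm_num at h'
  · intro p hp q hq h
    rcases hsep p hp q hq with (rfl | rfl | rfl) | h'
    · simp [cross] at h
    · simp [cross, mul_comm] at h
    · rw [show q - (q + (s + v)) = -(s + v) by abel] at h
      simp only [cross, Prod.fst_neg, Prod.snd_neg] at h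
      ring_nf at h
      omega
    · rw [h] at h'; norm_num at h'
  · rw [hcard]
    refine Nat.mul_le_mul_left 2 (Finset.card_le_card fun p hp => ?_)
    exact Finset.mem_filter.2 ⟨hleft p hp, hright p hp⟩
  · rw [hcard]
    have hsub : translatePairs P v ⊆ translatePairs P' (s + v) := by
      intro p hp
      obtain ⟨hp1, hp2⟩ := Finset.mem_filter.1 hp
      refine Finset.mem_filter.2 ⟨hleft p hp1, ?_⟩
      rw [show p + (s + v) = p + v + s by abel]
      exact hright _ hp2
    have := Finset.card_le_card hsub
    have := hD.card_le_v
    omega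

theorem exists_doublingData (i : ℕ) :
    ∃ P v w u, DoublingData P v w u ∧ P.card = 2 ^ (i + 2) ∧
      i * 2 ^ (i + 2) ≤ 8 * (unimodularTriangles P).card := by
  induction i with
  | zero => exact ⟨_, _, _, _, doublingData_base, by decide, by simp⟩
  | succ i ih =>
    obtain ⟨P, v, w, u, hD, hc, ht⟩ := ih
    obtain ⟨P', v', w', u', hD', hc', ht'⟩ := hD.exists_double
    refine ⟨P', v', w', u', hD', by rw [hc', hc]; ring, ?_⟩
    have := hD.card_le_w
    have e : (i + 1) * 2 ^ (i + 1 + 2) = 2 * (i * 2 ^ (i + 2)) + 2 * 2 ^ (i + 2) := by ring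
    rw [e, ← hc]
    rw [← hc] at ht
    omega

/-! ### Extension to arbitrary size -/

/-- A line meets the parabola `y = x ^ 2` at most twice, so a point far out on it avoids the
finitely many lines spanned by `S`. -/
theorem LatticeGeneral.exists_insert {S : Finset (ℤ × ℤ)} (hS : LatticeGeneral S) :
    ∃ z ∉ S, LatticeGeneral (insert z S) := by
  have ev1 : ∀ᶠ l : ℤ in Filter.atTop, ∀ p ∈ S, p.1 < l := by
    simp only [Filter.eventually_all_finset]
    exact fun p _ => Filter.eventually_gt_atTop _
  have ev2 : ∀ᶠ l : ℤ in Filter.atTop, ∀ p ∈ S, ∀ q ∈ S,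
      |(q - p).2| + |cross (q - p) p| < l := by
    simp only [Filter.eventually_all_finset]
    exact fun p _ q _ => Filter.eventually_gt_atTop _
  obtain ⟨l, h1, h2⟩ := (ev1.and ev2).exists
  have hz : (l, l ^ 2) ∉ S := fun h => lt_irrefl _ (h1 _ h)
  have hne : ∀ p ∈ S, ∀ q ∈ S, p ≠ q → cross (q - p) ((l, l ^ 2) - p) ≠ 0 := by
    intro p hp q hq hpq h0
    have e : (q - p).1 * l ^ 2 = (q - p).2 * l + cross (q - p) p := by
      simp only [cross, Prod.fst_sub, Prod.snd_sub] at h0 ⊢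
      linear_combination h0
    have hl := h2 p hp q hq
    have hl1 := h1 p hp
    -- A vertical line meets the parabola only at abscissa `p.1 < l`; otherwise the quadratic term
    -- dominates.
    by_cases hd : (q - p).1 = 0
    · have h3 : (q - p).2 * (l - p.1) = 0 := by
        simp only [cross, hd] at e
        linear_combination -e
      rcases mul_eq_zero.1 h3 with h | h
      · exact hpq (sub_eq_zero.1 (Prod.ext hd h)).symm
      · omega
    · have hone := Int.one_le_abs hd
      have a1 := abs_nonneg (q - p).2
      have a2 := abs_nonneg (cross (q - p) p)
      have hlpos : 1 ≤ l := by omega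
      have hle : |(q - p).1 * l ^ 2| ≤ |(q - p).2| * l + |cross (q - p) p| := by
        rw [e]
        refine (abs_add_le _ _).trans_eq ?_
        rw [abs_mul, abs_of_nonneg (by omega : 0 ≤ l)]
      rw [abs_mul, abs_of_nonneg (by positivity : 0 ≤ l ^ 2)] at hle
      nlinarith
  refine ⟨_, hz, ?_⟩
  intro p hp q hq r hr hpq hpr hqr h0
  rw [Finset.mem_insert] at hp hq hr
  rcases hp with rfl | hp <;> rcases hq with rfl | hq <;> rcases hr with rfl | hr <;>
    try contradiction
  · refine hne q hq r hr hqr ?_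
    simp only [cross, Prod.fst_sub, Prod.snd_sub] at h0 ⊢
    linear_combination h0
  · refine hne p hp r hr hpr ?_
    simp only [cross, Prod.fst_sub, Prod.snd_sub] at h0 ⊢
    linear_combination -h0
  · exact hne p hp q hq hpq h0
  · exact hS p hp q hq r hr hpq hpr hqr h0

theorem LatticeGeneral.exists_superset {S : Finset (ℤ × ℤ)} (hS : LatticeGeneral S) {n : ℕ}
    (hn : S.card ≤ n) : ∃ S', S ⊆ S' ∧ LatticeGeneral S' ∧ S'.card = n := by
  induction n, hn using Nat.le_induction with
  | base => exact ⟨S, Finset.Subset.refl _, hS, rfl⟩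
  | succ n _ ih =>
    obtain ⟨S', hsub, hg, hc⟩ := ih
    obtain ⟨z, hz, hg'⟩ := hg.exists_insert
    exact ⟨_, hsub.trans (Finset.subset_insert _ _), hg', by
      rw [Finset.card_insert_of_notMem hz, hc]⟩

/-! ### Transfer to the Euclidean plane -/

/-- The embedding of the integer lattice into the Euclidean plane. -/
noncomputable def latticePoint (p : ℤ × ℤ) : Plane := !₂[(p.1 : ℝ), (p.2 : ℝ)]

theorem latticePoint_injective : Function.Injective latticePoint := by
  intro p q h
  have h0 := congrArg (fun x : Plane => x 0) h
  have h1 := congrArg (fun x : Plane => x 1) h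
  simp only [latticePoint, PiLp.toLp_apply, Matrix.cons_val_zero, Matrix.cons_val_one] at h0 h1
  exact Prod.ext (by exact_mod_cast h0) (by exact_mod_cast h1)

theorem triangleArea_latticePoint (p q r : ℤ × ℤ) :
    triangleArea (latticePoint p) (latticePoint q) (latticePoint r) =
      ((|cross (q - p) (r - p)| : ℤ) : ℝ) / 2 := by
  simp only [triangleArea, latticePoint, cross, PiLp.toLp_apply, Matrix.cons_val_zero,
    Matrix.cons_val_one, Prod.fst_sub, Prod.snd_sub]
  push_cast
  congr 2
  ring

theorem triangleArea_eq_zero_of_collinear {p q r : Plane}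
    (h : Collinear ℝ ({p, q, r} : Set Plane)) : triangleArea p q r = 0 := by
  obtain ⟨d, hd⟩ := (collinear_iff_of_mem (p₀ := p) (by simp)).1 h
  obtain ⟨a, rfl⟩ := hd q (by simp)
  obtain ⟨b, rfl⟩ := hd r (by simp)
  simp [triangleArea]
  ring

theorem LatticeGeneral.noThreeCollinear_image {S : Finset (ℤ × ℤ)} (hS : LatticeGeneral S) :
    NoThreeCollinear (S.map ⟨latticePoint, latticePoint_injective⟩) := by
  intro p hp q hq r hr hpq hpr hqr hcol
  obtain ⟨p, hp', rfl⟩ := Finset.mem_map.1 hp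
  obtain ⟨q, hq', rfl⟩ := Finset.mem_map.1 hq
  obtain ⟨r, hr', rfl⟩ := Finset.mem_map.1 hr
  have h := triangleArea_eq_zero_of_collinear hcol
  simp only [Function.Embedding.coeFn_mk, triangleArea_latticePoint] at h
  refine hS p hp' q hq' r hr' (fun h => hpq (h ▸ rfl)) (fun h => hpr (h ▸ rfl))
    (fun h => hqr (h ▸ rfl)) ?_
  have h' : ((|cross (q - p) (r - p)| : ℤ) : ℝ) = 0 := by linarith
  exact abs_eq_zero.1 (by exact_mod_cast h')

theorem isMinAreaTriangle_map {S t : Finset (ℤ × ℤ)} (hts : t ⊆ S) (ht : Unimodular t) :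
    IsMinAreaTriangle (S.map ⟨latticePoint, latticePoint_injective⟩)
      (t.map ⟨latticePoint, latticePoint_injective⟩) := by
  obtain ⟨p, q, r, rfl, h⟩ := ht
  have hmem : ∀ x ∈ ({p, q, r} : Finset (ℤ × ℤ)),
      latticePoint x ∈ S.map ⟨latticePoint, latticePoint_injective⟩ := fun x hx =>
    Finset.mem_map.2 ⟨x, hts hx, rfl⟩
  refine ⟨latticePoint p, hmem p (by simp), latticePoint q, hmem q (by simp), latticePoint r,
    hmem r (by simp), by simp, ?_, ?_⟩
  · rw [triangleArea_latticePoint, h]; norm_num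
  · intro p' hp' q' hq' r' hr' hpos
    obtain ⟨p', -, rfl⟩ := Finset.mem_map.1 hp'
    obtain ⟨q', -, rfl⟩ := Finset.mem_map.1 hq'
    obtain ⟨r', -, rfl⟩ := Finset.mem_map.1 hr'
    simp only [Function.Embedding.coeFn_mk, triangleArea_latticePoint] at hpos ⊢
    rw [h]
    have h1 : 0 < |cross (q' - p') (r' - p')| := by
      have : (0 : ℝ) < ((|cross (q' - p') (r' - p')| : ℤ) : ℝ) := by linarith
      exact_mod_cast this
    have h2 : (1 : ℝ) ≤ ((|cross (q' - p') (r' - p')| : ℤ) : ℝ) := by exact_mod_cast h1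
    push_cast at h2 ⊢
    linarith

theorem card_unimodularTriangles_le (S : Finset (ℤ × ℤ)) :
    (unimodularTriangles S).card ≤
      numMinAreaTriangles (S.map ⟨latticePoint, latticePoint_injective⟩) := by
  set f : (ℤ × ℤ) ↪ Plane := ⟨latticePoint, latticePoint_injective⟩ with hf
  rw [numMinAreaTriangles, ← Finset.card_map ⟨Finset.map f, Finset.map_injective f⟩,
    ← Set.ncard_coe_finset]
  refine Set.ncard_le_ncard ?_ ?_
  · intro t ht
    obtain ⟨a, ha, rfl⟩ := Finset.mem_map.1 (Finset.mem_coe.1 ht)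
    obtain ⟨h1, h2⟩ := mem_unimodularTriangles.1 ha
    exact isMinAreaTriangle_map h1 h2
  · refine (S.map f).powerset.finite_toSet.subset ?_
    rintro t ⟨p, hp, q, hq, r, hr, ht, -⟩
    rw [Finset.mem_coe, Finset.mem_powerset, ← Finset.coe_subset, ht]
    intro x hx
    rcases hx with rfl | rfl | rfl <;> assumption

/-- A lattice configuration in general position can be extended to any larger size without losing
triangles of minimum area. -/
theorem LatticeGeneral.exists_plane {S : Finset (ℤ × ℤ)} (hS : LatticeGeneral S) {n : ℕ}
    (hn : S.card ≤ n) : ∃ P : Finset Plane, P.card = n ∧ NoThreeCollinear P ∧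
      (unimodularTriangles S).card ≤ numMinAreaTriangles P := by
  obtain ⟨S', hsub, hg, hc⟩ := hS.exists_superset hn
  refine ⟨_, (Finset.card_map _).trans hc, hg.noThreeCollinear_image,
    (Finset.card_le_card fun t ht => ?_).trans (card_unimodularTriangles_le S')⟩
  obtain ⟨h1, h2⟩ := mem_unimodularTriangles.1 ht
  exact mem_unimodularTriangles.2 ⟨h1.trans hsub, h2⟩

/-! ### The final bound -/

theorem theorem6 :
    ∃ c : ℝ, 0 < c ∧ ∀ n : ℕ, 3 ≤ n →
      ∃ P : Finset Plane, P.card = n ∧ NoThreeCollinear P ∧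
        c * ((n : ℝ) * Real.log (n : ℝ)) ≤ (numMinAreaTriangles P : ℝ) := by
  -- For `n ≥ 8`, 64 is 16 from `h1` times 4 from `h4`. For `n ≤ 7`, `n log n ≤ 7 * 6 < 64`, so one
  -- triangle suffices.
  refine ⟨1 / 64, by norm_num, fun n hn => ?_⟩
  have hn0 : (0 : ℝ) < n := by exact_mod_cast (by omega : 0 < n)
  rcases lt_or_ge n 8 with h8 | h8
  · have hS : LatticeGeneral {(0, 0), (1, 0), (0, 1)} := by unfold LatticeGeneral; decide
    obtain ⟨P, hc, hg, ht⟩ := hS.exists_plane (n := n) (le_trans (by decide) hn)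
    refine ⟨P, hc, hg, ?_⟩
    have h1 : 1 ≤ (unimodularTriangles {(0, 0), (1, 0), (0, 1)}).card :=
      Finset.card_pos.2 ⟨_, mem_unimodularTriangles.2
        ⟨Finset.Subset.refl _, (0, 0), (1, 0), (0, 1), rfl, by decide⟩⟩
    have h2 : (1 : ℝ) ≤ numMinAreaTriangles P := by exact_mod_cast h1.trans ht
    have h3 : Real.log n ≤ n - 1 := Real.log_le_sub_one_of_pos hn0
    have h4 : (n : ℝ) ≤ 7 := by exact_mod_cast (by omega : n ≤ 7)
    nlinarith
  · obtain ⟨i, hi⟩ : ∃ i, Nat.log 2 n = i + 3 :=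
      ⟨Nat.log 2 n - 3, by
        have : 3 ≤ Nat.log 2 n := Nat.le_log_of_pow_le (by norm_num) h8
        omega⟩
    have hlow : 2 ^ (i + 3) ≤ n := hi ▸ Nat.pow_log_le_self 2 (by omega)
    have hupp : n < 2 ^ (i + 4) := by
      have := Nat.lt_pow_succ_log_self (by norm_num : 1 < 2) n
      rwa [hi] at this
    obtain ⟨S, v, w, u, hD, hSc, hSt⟩ := exists_doublingData (i + 1)
    obtain ⟨P, hc, hg, ht⟩ := hD.general.exists_plane (n := n) (hSc ▸ hlow)
    refine ⟨P, hc, hg, ?_⟩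
    -- Rounding `n` down to a power of two costs a factor 2, turning 8 into 16.
    have h1 : (i + 1) * n ≤ 16 * numMinAreaTriangles P := by
      have : (i + 1) * n ≤ (i + 1) * 2 ^ (i + 4) := Nat.mul_le_mul_left _ hupp.le
      have e : (i + 1) * 2 ^ (i + 4) = 2 * ((i + 1) * 2 ^ (i + 1 + 2)) := by ring
      omega
    have h2 : ((i : ℝ) + 1) * n ≤ 16 * numMinAreaTriangles P := by exact_mod_cast h1
    have h3 : Real.log n ≤ (i + 4) * 1 := by
      have hle : Real.log n ≤ Real.log ((2 : ℝ) ^ (i + 4)) :=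
        Real.log_le_log hn0 (by exact_mod_cast hupp.le)
      rw [Real.log_pow] at hle
      push_cast at hle
      have hl2 : Real.log 2 ≤ 1 := by linarith [Real.log_two_lt_d9]
      exact hle.trans (mul_le_mul_of_nonneg_left hl2 (by positivity))
    have h4 : Real.log n ≤ 4 * ((i : ℝ) + 1) := by
      have : (0 : ℝ) ≤ i := by positivity
      linarith
    have h5 : (n : ℝ) * Real.log n ≤ n * (4 * ((i : ℝ) + 1)) :=
      mul_le_mul_of_nonneg_left h4 hn0.le
    linarith
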